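/- **Definitions.** In a partially ordered set, $x$ is *way-below* $y$, written $x\ll y$, if for every increasing sequence $(y_n)_n$ that has a supremum with $y\leq\sup_n y_n$ there is $n$ with $x\leq y_n$. A *$\mathrm{Cu}$-semigroup* is a commutative, positively ordered monoid $S$ (the order is a partial order compatible with addition, and $0\leq x$ for all $x$) such that: (O1) every increasing sequence has a supremum; (O2) every element is the supremum of a $\ll$-increasing sequence; (O3) $x'\ll x$ and $y'\ll y$ imply $x'+y'\ll x+y$; (O4) $\sup_n x_n+\sup_n y_n=\sup_n(x_n+y_n)$ for all increasing sequences $(x_n)_n$, $(y_n)_n$. Consider further the properties: * (O5) if $x+y\leq z$, $x'\ll x$ and $y'\ll y$, then there is $c$ with $x'+c\leq z\leq x+c$ and $y'\ll c$; * (O6) if $x'\ll x\leq y+z$, then there are $v\leq x,y$ and $w\leq x,z$ with $x'\leq v+w$. $S$ is *weakly cancellative* if $x+z\ll y+z$ implies $x\ll y$. A subset $D\subseteq S$ is *sup-dense* if whenever $x'\ll x$ in $S$ there is $y\in D$ with $x'\leq y\ll x$; $S$ is *countably based* if it has a countable sup-dense subset. An *ideal* is a downward-hereditary submonoid closed under suprema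 of increasing sequences, and $S$ is *simple* if its only ideals are $\{0\}$ and $S$. An element $x$ is *compact* if $x\ll x$, and $S$ is *algebraic* if its compact elements are sup-dense. An element $x$ is *soft* if $x=0$, or if $x\neq 0$ and for every $x'\ll x$ there is a nonzero $t\in S$ with $x'+t\ll x$; $S$ is *soft* if all of its elements are soft. The soft elements of $S$ form a submonoid $S_{\mathrm{soft}}$, ordered as a subset of $S$. An element $x$ has *thin boundary* if $x\ll x+t$ for every nonzero $t\in S$. For $n\in\mathbb{N}=\{0,1,2,\ldots\}$, we write $\dim(S)\leq n$ if whenever $x'\ll x\ll y_1+\ldots+y_r$ in $S$ there are $z_{j,k}\in S$ ($1\leq j\leq r$, $0\leq k\leq n$) such that $z_{j,k}\ll y_j$ for all $j,k$, $x'\ll\sum_{j,k}z_{j,k}$, and $\sum_{j}z_{j,k}\ll x$ for each $k$; the *dimension* $\dim(S)\in\{0,1,\ldots,\infty\}$ is the smallest such $n$, or $\infty$ if there is none. **Theorem.** Let $S$ be a countably based, simple, soft, weakly cancellative $\mathrm{Cu}$-semigroup satisfying (O5) and (O6). Then the following conditions are equivalent: 1. $\dim(S)=0$; 2. the elements of $S$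 with thin boundary are sup-dense in $S$; 3. there exists a countably based, simple, algebraic, weakly cancellative $\mathrm{Cu}$-semigroup $T$ satisfying (O5) and (O6) such that $S\cong T_{\mathrm{soft}}$ (isomorphism of ordered monoids, which is the same as isomorphism of $\mathrm{Cu}$-semigroups). -/

import Mathlib

namespace CuntzSemigroup

section Order

variable {S : Type*} [PartialOrder S]

/-- `x` is way-below `y` (sequential version, written `x ≪ y` in the comments): every increasing
sequence that has a supremum `s` with `y ≤ s` has a term that dominates `x`. -/
def WayBelow (x y : S) : Prop :=
  ∀ u : ℕ → S, Monotone u → ∀ s : S, IsLUB (Set.range u) s → y ≤ s → ∃ n, x ≤ u n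

/-- A subset `D` is sup-dense if `x' ≪ x` implies `x' ≤ y ≪ x` for some `y ∈ D`. -/
def IsSupDense (D : Set S) : Prop :=
  ∀ x' x : S, WayBelow x' x → ∃ y ∈ D, x' ≤ y ∧ WayBelow y x

/-- An element is compact if it is way-below itself. -/
def IsCompactElt (x : S) : Prop := WayBelow x x

theorem WayBelow.trans_le {x y z : S} (h : WayBelow x y) (hyz : y ≤ z) : WayBelow x z :=
  fun u hu s hs hz => h u hu s hs (hyz.trans hz)

theorem WayBelow.le_trans {x y z : S} (hxy : x ≤ y) (h : WayBelow y z) : WayBelow x z :=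
  fun u hu s hs hz => (h u hu s hs hz).imp fun _ hn => hxy.trans hn

end Order

/-- A `Cu`-semigroup: a commutative positively ordered monoid satisfying (O1)-(O4). -/
class IsCuSemigroup (S : Type*) [AddCommMonoid S] [PartialOrder S] : Prop
    extends IsOrderedAddMonoid S where
  /-- The order is positive. -/
  zero_le : ∀ x : S, 0 ≤ x
  /-- (O1): every increasing sequence has a supremum. -/
  exists_sup : ∀ u : ℕ → S, Monotone u → ∃ s, IsLUB (Set.range u) s
  /-- (O2): every element is the supremum of a `≪`-increasing sequence. -/
  exists_wayBelow_seq : ∀ x : S, ∃ u : ℕ → S,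
    (∀ n, WayBelow (u n) (u (n + 1))) ∧ IsLUB (Set.range u) x
  /-- (O3): addition preserves the way-below relation. -/
  wayBelow_add : ∀ x' x y' y : S, WayBelow x' x → WayBelow y' y → WayBelow (x' + y') (x + y)
  /-- (O4): addition preserves suprema of increasing sequences. -/
  sup_add : ∀ u v : ℕ → S, Monotone u → Monotone v → ∀ a b : S,
    IsLUB (Set.range u) a → IsLUB (Set.range v) b →
      IsLUB (Set.range fun n => u n + v n) (a + b)

section Properties

variable (S : Type*) [AddCommMonoid S] [PartialOrder S]

/-- Axiom (O5). -/
def O5 : Prop :=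
  ∀ x' x y' y z : S, x + y ≤ z → WayBelow x' x → WayBelow y' y →
    ∃ c : S, x' + c ≤ z ∧ z ≤ x + c ∧ WayBelow y' c

/-- Axiom (O6). -/
def O6 : Prop :=
  ∀ x' x y z : S, WayBelow x' x → x ≤ y + z →
    ∃ v w : S, v ≤ x ∧ v ≤ y ∧ w ≤ x ∧ w ≤ z ∧ x' ≤ v + w

/-- Weak cancellation: `x + z ≪ y + z` implies `x ≪ y`. -/
def WeaklyCancellative : Prop :=
  ∀ x y z : S, WayBelow (x + z) (y + z) → WayBelow x y

/-- There is a countable sup-dense subset. -/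
def CountablyBased : Prop :=
  ∃ D : Set S, D.Countable ∧ IsSupDense D

/-- The compact elements are sup-dense. -/
def Algebraic : Prop :=
  IsSupDense {x : S | IsCompactElt x}

variable {S} in
/-- An ideal is a downward-hereditary submonoid closed under suprema of increasing sequences. -/
def IsIdeal (I : AddSubmonoid S) : Prop :=
  (∀ x y : S, x ≤ y → y ∈ I → x ∈ I) ∧
    ∀ u : ℕ → S, Monotone u → (∀ n, u n ∈ I) → ∀ s : S, IsLUB (Set.range u) s → s ∈ I

/-- `S` is simple if `{0}` and `S` are its only ideals. -/
def Simple : Prop :=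
  ∀ I : AddSubmonoid S, IsIdeal I → I = ⊥ ∨ I = ⊤

/-- The condition `dim(S) ≤ n`: whenever `x' ≪ x ≪ y₁ + … + yᵣ`, there are `z j k`, for
`j = 1, …, r` and `k = 0, …, n`, with `z j k ≪ y j`, with `x' ≪ ∑ z j k`, and with
`∑ⱼ z j k ≪ x` for each `k`. -/
def DimLE (n : ℕ) : Prop :=
  ∀ (x' x : S) (r : ℕ) (y : Fin r → S), WayBelow x' x → WayBelow x (∑ j, y j) →
    ∃ z : Fin r → Fin (n + 1) → S,
      (∀ j k, WayBelow (z j k) (y j)) ∧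
      WayBelow x' (∑ j, ∑ k, z j k) ∧
      ∀ k, WayBelow (∑ j, z j k) x

/-- The covering dimension: the least `n` with `dim(S) ≤ n`, and `∞` if there is none. -/
noncomputable def dim : ℕ∞ :=
  sInf {d : ℕ∞ | ∃ n : ℕ, d = n ∧ DimLE S n}

variable {S}

/-- `x` has thin boundary if `x ≪ x + t` for every nonzero `t`. -/
def HasThinBoundary (x : S) : Prop :=
  ∀ t : S, t ≠ 0 → WayBelow x (x + t)

/-- `x` is soft if `x = 0`, or `x ≠ 0` and for every `x' ≪ x` there is a nonzero `t` with
`x' + t ≪ x`. -/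
def IsSoft (x : S) : Prop :=
  x = 0 ∨ (x ≠ 0 ∧ ∀ x' : S, WayBelow x' x → ∃ t : S, t ≠ 0 ∧ WayBelow (x' + t) x)

variable (S) in
/-- `S` is soft if all its elements are soft. -/
def Soft : Prop :=
  ∀ x : S, IsSoft x

end Properties

section SoftPart

variable {S : Type*} [AddCommMonoid S] [PartialOrder S] [IsCuSemigroup S]

theorem exists_le_add_of_wayBelow_add {z x y : S} (h : WayBelow z (x + y)) :
    ∃ x' y' : S, WayBelow x' x ∧ WayBelow y' y ∧ z ≤ x' + y' := by
  obtain ⟨u, hu, hux⟩ := IsCuSemigroup.exists_wayBelow_seq x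
  obtain ⟨v, hv, hvy⟩ := IsCuSemigroup.exists_wayBelow_seq y
  have le_of : ∀ {a b : S}, WayBelow a b → a ≤ b := fun {a b} hab => by
    obtain ⟨n, hn⟩ := hab (fun _ => b) monotone_const b (by simp) le_rfl
    exact hn
  have hum : Monotone u := monotone_nat_of_le_succ fun n => le_of (hu n)
  have hvm : Monotone v := monotone_nat_of_le_succ fun n => le_of (hv n)
  obtain ⟨n, hn⟩ := h (fun n => u n + v n) (fun i j hij => add_le_add (hum hij) (hvm hij)) _
    (IsCuSemigroup.sup_add u v hum hvm x y hux hvy) le_rfl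
  exact ⟨u n, v n, (hu n).trans_le (hux.1 ⟨n + 1, rfl⟩),
    (hv n).trans_le (hvy.1 ⟨n + 1, rfl⟩), hn⟩

theorem IsSoft.add {x y : S} (hx : IsSoft x) (hy : IsSoft y) : IsSoft (x + y) := by
  rcases hx with rfl | ⟨hx0, hx⟩
  · simpa using hy
  · refine Or.inr ⟨fun h => hx0 (le_antisymm ?_ (IsCuSemigroup.zero_le x)), fun z hz => ?_⟩
    · calc x = x + 0 := (add_zero x).symm
        _ ≤ x + y := add_le_add le_rfl (IsCuSemigroup.zero_le y)
        _ = 0 := h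
    · obtain ⟨x', y', hx', hy', hle⟩ := exists_le_add_of_wayBelow_add hz
      obtain ⟨t, ht0, ht⟩ := hx x' hx'
      refine ⟨t, ht0, WayBelow.le_trans ?_ (IsCuSemigroup.wayBelow_add _ _ _ _ ht hy')⟩
      calc z + t ≤ x' + y' + t := add_le_add hle le_rfl
        _ = x' + t + y' := add_right_comm _ _ _

variable (S) in
/-- The soft part of `S`: the submonoid of soft elements, with the order induced from `S`. -/
def softPart : AddSubmonoid S where
  carrier := {x | IsSoft x}
  zero_mem' := Or.inl rfl
  add_mem' := IsSoft.add

end SoftPart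

end CuntzSemigroup

universe u

open CuntzSemigroup

/-! Elements with thin boundary are compact up to arbitrarily small errors. Softness of `S` always
leaves room for such an error, and weak cancellation removes it afterwards.

If the dimension is zero, a pair `u ≪ v` can be narrowed to `u ≪ w' ≪ w ≪ v` with `w ≪ w' + t` for
any prescribed `t ≠ 0` (`DimLE.exists_wayBelow_add_between`). Let `t` run through a countable family
that is coinitial among the nonzero elements; the supremum of the lower ends then has thin boundary.
Conversely, a thin element way-below `s` has an exact complement in `s`, so (O6) sharpens to exact
Riesz decomposition of thin elements, which gives dimension zero.

To build `T`, take a countable sup-dense monoid of thin elements, closed under complements and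
decompositions (`CompactCore`), and adjoin a compact copy of each to `S` (`CompactCore.Ext`). Apart
from equality, the copy of `a` lies below `q` exactly when `a ≪ q` in `S`.

In the other direction, a nonzero compact `c` of `T` can be split forever, with remainders that
become smaller than any given nonzero element. The split-off parts add up to a soft `b ≤ c` with `c
≤ b + t` for all `t ≠ 0` (`IsCompactElt.exists_isSoft_le`). Then `b ≤ c ≪ c ≤ b + t`, so `b` is
thin, and such `b` are sup-dense in the soft part. -/

namespace CuntzSemigroup

/-! ### Way-below calculus and approximating sequences -/

section Basic

variable {S : Type*} [PartialOrder S]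

theorem WayBelow.le {x y : S} (h : WayBelow x y) : x ≤ y := by
  obtain ⟨n, hn⟩ := h (fun _ => y) monotone_const y (by simp) le_rfl
  exact hn

theorem WayBelow.trans {x y z : S} (hxy : WayBelow x y) (hyz : WayBelow y z) : WayBelow x z :=
  hxy.trans_le hyz.le

theorem monotone_of_wayBelow_succ {u : ℕ → S} (hu : ∀ n, WayBelow (u n) (u (n + 1))) :
    Monotone u :=
  monotone_nat_of_le_succ fun n => (hu n).le

theorem wayBelow_of_isLUB {u : ℕ → S} (hu : ∀ n, WayBelow (u n) (u (n + 1))) {x : S}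
    (hx : IsLUB (Set.range u) x) (n : ℕ) : WayBelow (u n) x :=
  (hu n).trans_le (hx.1 ⟨n + 1, rfl⟩)

variable [AddCommMonoid S]

theorem WeaklyCancellative.cancel_left (hc : WeaklyCancellative S) {x y z : S}
    (h : WayBelow (z + x) (z + y)) : WayBelow x y :=
  hc x y z (by rwa [add_comm x, add_comm y])

variable [IsCuSemigroup S]

theorem nonneg (x : S) : 0 ≤ x := IsCuSemigroup.zero_le x

theorem le_self_add (x y : S) : x ≤ x + y := by
  simpa using add_le_add (le_refl x) (nonneg y)

theorem le_add_self (x y : S) : x ≤ y + x := by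
  simpa using add_le_add (nonneg y) (le_refl x)

theorem eq_zero_of_le {x : S} (h : x ≤ 0) : x = 0 := le_antisymm h (nonneg x)

theorem add_eq_zero_left {x y : S} (h : x + y = 0) : x = 0 :=
  eq_zero_of_le (h ▸ le_self_add x y)

theorem add_eq_zero_right {x y : S} (h : x + y = 0) : y = 0 :=
  eq_zero_of_le (h ▸ le_add_self y x)

theorem ne_zero_of_le {x y : S} (hx : x ≠ 0) (h : x ≤ y) : y ≠ 0 := by
  rintro rfl
  exact hx (eq_zero_of_le h)

theorem zero_wayBelow (x : S) : WayBelow 0 x := fun u _ _ _ _ => ⟨0, nonneg (u 0)⟩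

theorem WayBelow.add {x' x y' y : S} (hx : WayBelow x' x) (hy : WayBelow y' y) :
    WayBelow (x' + y') (x + y) :=
  IsCuSemigroup.wayBelow_add _ _ _ _ hx hy

theorem WayBelow.sum {ι : Type*} (s : Finset ι) {f g : ι → S}
    (h : ∀ i ∈ s, WayBelow (f i) (g i)) : WayBelow (∑ i ∈ s, f i) (∑ i ∈ s, g i) := by
  classical
  induction s using Finset.induction_on with
  | empty => simpa using zero_wayBelow (0 : S)
  | insert a s ha ih =>
    rw [Finset.sum_insert ha, Finset.sum_insert ha]
    exact (h a (Finset.mem_insert_self a s)).add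
      (ih fun i hi => h i (Finset.mem_insert_of_mem hi))

theorem WayBelow.interpolate {x z : S} (h : WayBelow x z) :
    ∃ y, WayBelow x y ∧ WayBelow y z := by
  obtain ⟨u, hu, hz⟩ := IsCuSemigroup.exists_wayBelow_seq z
  obtain ⟨n, hn⟩ := h u (monotone_of_wayBelow_succ hu) z hz le_rfl
  exact ⟨u (n + 1), (hu n).le_trans hn, wayBelow_of_isLUB hu hz _⟩

theorem WayBelow.exists_wayBelow_term {x s : S} (h : WayBelow x s) {u : ℕ → S}
    (hu : Monotone u) (hs : IsLUB (Set.range u) s) : ∃ n, WayBelow x (u n) := by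
  obtain ⟨y, hxy, hy⟩ := h.interpolate
  obtain ⟨n, hn⟩ := hy u hu s hs le_rfl
  exact ⟨n, hxy.trans_le hn⟩

theorem le_of_forall_wayBelow {x y : S} (h : ∀ x', WayBelow x' x → x' ≤ y) : x ≤ y := by
  obtain ⟨u, hu, hx⟩ := IsCuSemigroup.exists_wayBelow_seq x
  refine hx.2 ?_
  rintro _ ⟨n, rfl⟩
  exact h _ (wayBelow_of_isLUB hu hx n)

theorem exists_ne_zero_wayBelow {x : S} (hx : x ≠ 0) : ∃ x', x' ≠ 0 ∧ WayBelow x' x := by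
  by_contra! h
  refine hx (eq_zero_of_le (le_of_forall_wayBelow fun x' hx' => ?_))
  by_contra hne
  exact h x' (fun h0 => hne h0.le) hx'

theorem WayBelow.exists_wayBelow_add_left {z x y : S} (h : WayBelow z (x + y)) :
    ∃ x', WayBelow x' x ∧ WayBelow z (x' + y) := by
  obtain ⟨w, hzw, hw⟩ := h.interpolate
  obtain ⟨x', y', hx', hy', hle⟩ := exists_le_add_of_wayBelow_add hw
  exact ⟨x', hx', hzw.trans_le (hle.trans (add_le_add le_rfl hy'.le))⟩

theorem isLUB_const_add (a : S) {u : ℕ → S} (hu : Monotone u) {x : S}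
    (hx : IsLUB (Set.range u) x) : IsLUB (Set.range fun n => a + u n) (a + x) :=
  IsCuSemigroup.sup_add (fun _ => a) u monotone_const hu a x (by simp) hx

/-- If the elements of `D` way-below `x` are cofinal among those way-below `x`, then `x` is the
supremum of a `≪`-increasing sequence in `D`. -/
theorem exists_wayBelow_seq_mem {x : S} {D : Set S}
    (h : ∀ y, WayBelow y x → ∃ z ∈ D, y ≤ z ∧ WayBelow z x) :
    ∃ d : ℕ → S, (∀ n, d n ∈ D) ∧ (∀ n, WayBelow (d n) (d (n + 1))) ∧ IsLUB (Set.range d) x := by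
  obtain ⟨v, hv, hvx⟩ := IsCuSemigroup.exists_wayBelow_seq x
  have hvm := monotone_of_wayBelow_succ hv
  have step : ∀ (n : ℕ) (y : {z // z ∈ D ∧ WayBelow z x}),
      ∃ z : {z // z ∈ D ∧ WayBelow z x}, WayBelow y.1 z.1 ∧ v n ≤ z.1 := by
    intro n y
    obtain ⟨m, hm⟩ := y.2.2.exists_wayBelow_term hvm hvx
    obtain ⟨z, hzD, hz, hzx⟩ := h (v (max m n)) (wayBelow_of_isLUB hv hvx _)
    exact ⟨⟨z, hzD, hzx⟩, hm.trans_le ((hvm (le_max_left _ _)).trans hz),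
      (hvm (le_max_right _ _)).trans hz⟩
  choose f hf using step
  obtain ⟨z₀, hz₀D, -, hz₀⟩ := h 0 (zero_wayBelow x)
  let d : ℕ → {z // z ∈ D ∧ WayBelow z x} := fun n => Nat.rec ⟨z₀, hz₀D, hz₀⟩ (fun n y => f n y) n
  refine ⟨fun n => (d n).1, fun n => (d n).2.1, fun n => (hf n (d n)).1, ?_, ?_⟩
  · rintro _ ⟨n, rfl⟩
    exact (d n).2.2.le
  · intro b hb
    refine hvx.2 ?_
    rintro _ ⟨n, rfl⟩
    exact (hf n (d n)).2.trans (hb ⟨n + 1, rfl⟩)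

theorem IsSupDense.exists_wayBelow_seq {D : Set S} (hD : IsSupDense D) (x : S) :
    ∃ d : ℕ → S, (∀ n, d n ∈ D) ∧ (∀ n, WayBelow (d n) (d (n + 1))) ∧ IsLUB (Set.range d) x :=
  exists_wayBelow_seq_mem fun y hy => hD y x hy

/-- In a countably based `Cu`-semigroup there is a sequence such that every nonzero element
dominates a nonzero term. -/
theorem CountablyBased.exists_seq (h : CountablyBased S) :
    ∃ t : ℕ → S, ∀ x, x ≠ 0 → ∃ n, t n ≠ 0 ∧ t n ≤ x := by
  obtain ⟨D, hD, hdense⟩ := h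
  have hne : D.Nonempty := by
    obtain ⟨y, hy, -⟩ := hdense 0 0 (zero_wayBelow 0)
    exact ⟨y, hy⟩
  obtain ⟨t, rfl⟩ := hD.exists_eq_range hne
  refine ⟨t, fun x hx => ?_⟩
  obtain ⟨x', hx'0, hx'⟩ := exists_ne_zero_wayBelow hx
  obtain ⟨_, ⟨n, rfl⟩, hle, hwb⟩ := hdense x' x hx'
  exact ⟨n, ne_zero_of_le hx'0 hle, hwb.le⟩

end Basic

/-! ### Ideals and common lower bounds in simple semigroups -/

section Simple

variable {S : Type*} [AddCommMonoid S] [PartialOrder S] [IsCuSemigroup S]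

/-- The ideal generated by `y`. -/
def idealSpan (y : S) : AddSubmonoid S where
  carrier := {x | ∀ x', WayBelow x' x → ∃ n : ℕ, x' ≤ n • y}
  zero_mem' := fun x' hx' => ⟨0, by simpa using hx'.le⟩
  add_mem' := by
    intro a b ha hb x' hx'
    obtain ⟨a', b', ha', hb', hle⟩ := exists_le_add_of_wayBelow_add hx'
    obtain ⟨m, hm⟩ := ha a' ha'
    obtain ⟨n, hn⟩ := hb b' hb'
    exact ⟨m + n, hle.trans (by rw [add_nsmul]; exact add_le_add hm hn)⟩

theorem isIdeal_idealSpan (y : S) : IsIdeal (idealSpan y) := by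
  refine ⟨fun a b hab hb x' hx' => hb x' (hx'.trans_le hab), fun u hu hmem s hs x' hx' => ?_⟩
  obtain ⟨n, hn⟩ := hx'.exists_wayBelow_term hu hs
  exact hmem n x' hn

theorem Simple.exists_le_nsmul (hS : Simple S) {x' x y : S} (hy : y ≠ 0) (h : WayBelow x' x) :
    ∃ n : ℕ, x' ≤ n • y := by
  have hmem : y ∈ idealSpan y := fun y' hy' => ⟨1, by simpa using hy'.le⟩
  rcases hS _ (isIdeal_idealSpan y) with hI | hI
  · rw [hI, AddSubmonoid.mem_bot] at hmem
    exact absurd hmem hy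
  · have hx : x ∈ idealSpan y := hI ▸ AddSubmonoid.mem_top x
    exact hx x' h

theorem O6.exists_ne_zero_le_of_le_nsmul (hO6 : O6 S) {y : S} (n : ℕ) :
    ∀ x : S, x ≠ 0 → x ≤ n • y → ∃ v, v ≠ 0 ∧ v ≤ x ∧ v ≤ y := by
  induction n with
  | zero => intro x hx h; exact absurd (eq_zero_of_le (by simpa using h)) hx
  | succ n ih =>
    intro x hx h
    obtain ⟨x', hx'0, hx'⟩ := exists_ne_zero_wayBelow hx
    obtain ⟨v, w, hvx, hvy, hwx, hwy, hle⟩ := hO6 x' x (n • y) y hx' (by rwa [succ_nsmul] at h)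
    by_cases hv : v = 0
    · exact ⟨w, ne_zero_of_le hx'0 (by simpa [hv] using hle), hwx, hwy⟩
    · obtain ⟨v', hv'0, hv'v, hv'y⟩ := ih v hv hvy
      exact ⟨v', hv'0, hv'v.trans hvx, hv'y⟩

/-- Simplicity puts a nonzero `x' ≪ x` below a multiple of `y`, and (O6) splits `x'` along the
copies of `y`; some piece is nonzero. This is the source of small elements throughout. -/
theorem Simple.exists_ne_zero_le (hS : Simple S) (hO6 : O6 S) {x y : S} (hx : x ≠ 0)
    (hy : y ≠ 0) : ∃ v, v ≠ 0 ∧ v ≤ x ∧ v ≤ y := by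
  obtain ⟨x', hx'0, hx'⟩ := exists_ne_zero_wayBelow hx
  obtain ⟨n, hn⟩ := hS.exists_le_nsmul hy hx'
  obtain ⟨v, hv0, hvx, hvy⟩ := hO6.exists_ne_zero_le_of_le_nsmul n x' hx'0 hn
  exact ⟨v, hv0, hvx.trans hx'.le, hvy⟩

end Simple

/-! ### Soft elements -/

section Soft

variable {S : Type*} [AddCommMonoid S] [PartialOrder S]

theorem IsSoft.exists_add_wayBelow {x' x : S} (hx : IsSoft x) (h0 : x ≠ 0)
    (h : WayBelow x' x) : ∃ t, t ≠ 0 ∧ WayBelow (x' + t) x := by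
  rcases hx with rfl | ⟨-, hx⟩
  · exact absurd rfl h0
  · exact hx x' h

variable [IsCuSemigroup S]

theorem IsSoft.add_right_of_ne_zero {x : S} (hx : IsSoft x) (hx0 : x ≠ 0) (y : S) :
    IsSoft (y + x) := by
  refine Or.inr ⟨fun h => hx0 (add_eq_zero_right h), fun z hz => ?_⟩
  obtain ⟨y', x', hy', hx', hle⟩ := exists_le_add_of_wayBelow_add hz
  obtain ⟨t, ht0, ht⟩ := hx.exists_add_wayBelow hx0 hx'
  refine ⟨t, ht0, WayBelow.le_trans ?_ (hy'.add ht)⟩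
  rw [← add_assoc]
  exact add_le_add hle le_rfl

theorem isSoft_of_isLUB {u : ℕ → S} (hu : Monotone u) (hsoft : ∀ n, IsSoft (u n)) {s : S}
    (hs : IsLUB (Set.range u) s) : IsSoft s := by
  by_cases h0 : s = 0
  · exact Or.inl h0
  refine Or.inr ⟨h0, fun x' hx' => ?_⟩
  obtain ⟨y, hy0, hy⟩ := exists_ne_zero_wayBelow h0
  obtain ⟨n, hn⟩ := hx'.exists_wayBelow_term hu hs
  obtain ⟨m, hm⟩ := hy.exists_wayBelow_term hu hs
  have hne : u (max n m) ≠ 0 := ne_zero_of_le hy0 (hm.le.trans (hu (le_max_right _ _)))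
  obtain ⟨t, ht0, ht⟩ := (hsoft (max n m)).exists_add_wayBelow hne
    (hn.trans_le (hu (le_max_left _ _)))
  exact ⟨t, ht0, ht.trans_le (hs.1 ⟨_, rfl⟩)⟩

theorem IsSoft.eq_zero_of_isCompactElt (hc : WeaklyCancellative S) {x : S} (hx : IsSoft x)
    (h : IsCompactElt x) : x = 0 := by
  by_contra h0
  obtain ⟨t, ht0, ht⟩ := hx.exists_add_wayBelow h0 h
  refine ht0 (eq_zero_of_le (hc.cancel_left (z := x) ?_).le)
  rwa [add_zero]

theorem Soft.exists_two_add_le (hsoft : Soft S) (hS : Simple S) (hO6 : O6 S) {t : S}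
    (ht : t ≠ 0) : ∃ s, s ≠ 0 ∧ s + s ≤ t := by
  obtain ⟨x, hx0, hx⟩ := exists_ne_zero_wayBelow ht
  obtain ⟨y, hy0, hy⟩ := (hsoft t).exists_add_wayBelow ht hx
  obtain ⟨s, hs0, hsx, hsy⟩ := hS.exists_ne_zero_le hO6 hx0 hy0
  exact ⟨s, hs0, (add_le_add hsx hsy).trans hy.le⟩

end Soft

/-! ### Dimension zero -/

section Dimension

variable {S : Type*} [AddCommMonoid S] [PartialOrder S]

theorem dim_eq_zero_iff : dim S = 0 ↔ DimLE S 0 := by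
  constructor
  · intro h
    have hne : {d : ℕ∞ | ∃ n : ℕ, d = n ∧ DimLE S n}.Nonempty := by
      by_contra hempty
      rw [Set.not_nonempty_iff_eq_empty] at hempty
      rw [dim, hempty, sInf_empty] at h
      exact ENat.top_ne_zero h
    have hmem := csInf_mem hne
    change dim S ∈ _ at hmem
    obtain ⟨n, hn, hdim⟩ := hmem
    rw [h] at hn
    have : n = 0 := by exact_mod_cast hn.symm
    exact this ▸ hdim
  · intro h
    exact le_antisymm (sInf_le ⟨0, rfl, h⟩) bot_le

theorem DimLE.exists_decomposition (h : DimLE S 0) {x' x y₁ y₂ : S} (hx : WayBelow x' x)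
    (hxy : WayBelow x (y₁ + y₂)) :
    ∃ z₁ z₂, WayBelow z₁ y₁ ∧ WayBelow z₂ y₂ ∧ WayBelow x' (z₁ + z₂) ∧ WayBelow (z₁ + z₂) x := by
  obtain ⟨z, hzy, hxz, hzx⟩ := h x' x 2 ![y₁, y₂] hx (by simpa using hxy)
  refine ⟨z 0 0, z 1 0, by simpa using hzy 0 0, by simpa using hzy 1 0, ?_, ?_⟩
  · simpa using hxz
  · simpa using hzx 0

end Dimension

/-! ### From dimension zero to thin boundaries -/

section ZeroDimensional

variable {S : Type*} [AddCommMonoid S] [PartialOrder S] [IsCuSemigroup S]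

theorem WayBelow.exists_chain {x y : S} (h : WayBelow x y) :
    ∃ u : ℕ → S, u 0 = x ∧ (∀ n, WayBelow (u n) (u (n + 1))) ∧ ∀ n, WayBelow (u n) y := by
  have step : ∀ z : {z // WayBelow z y}, ∃ w : {z // WayBelow z y}, WayBelow z.1 w.1 := by
    intro z
    obtain ⟨w, hzw, hw⟩ := z.2.interpolate
    exact ⟨⟨w, hw⟩, hzw⟩
  choose f hf using step
  let u : ℕ → {z // WayBelow z y} := fun n => Nat.rec ⟨x, h⟩ (fun _ z => f z) n
  exact ⟨fun n => (u n).1, rfl, fun n => hf (u n), fun n => (u n).2⟩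

/-- There are arbitrarily large pairs `e' ≪ e` with `e ≤ e' + t`: telescope a long
`≪`-increasing chain below `t`. -/
theorem Simple.exists_large_le_add (hS : Simple S) {v v' t : S} (hv : WayBelow v v')
    (ht : t ≠ 0) : ∃ e' e, v ≤ e' ∧ WayBelow e' e ∧ e ≤ e' + t := by
  obtain ⟨x, hx0, hx⟩ := exists_ne_zero_wayBelow ht
  obtain ⟨N, hN⟩ := hS.exists_le_nsmul hx0 hv
  obtain ⟨u, rfl, hu, hut⟩ := hx.exists_chain
  refine ⟨∑ i ∈ Finset.range N, u i, ∑ i ∈ Finset.range N, u (i + 1), hN.trans ?_,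
    WayBelow.sum _ fun i _ => hu i, ?_⟩
  · calc N • u 0 = ∑ _i ∈ Finset.range N, u 0 := by simp
      _ ≤ _ := Finset.sum_le_sum fun i _ => monotone_of_wayBelow_succ hu (Nat.zero_le i)
  · calc ∑ i ∈ Finset.range N, u (i + 1) ≤ ∑ i ∈ Finset.range N, u (i + 1) + u 0 :=
          le_self_add _ _
      _ = ∑ i ∈ Finset.range N, u i + u N := by
          rw [← Finset.sum_range_succ', Finset.sum_range_succ]
      _ ≤ _ := add_le_add le_rfl (hut N).le

variable (hS : Simple S) (hsoft : Soft S) (hc : WeaklyCancellative S) (hO5 : O5 S) (hO6 : O6 S)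

include hS hsoft hc hO5 hO6 in
-- Dimension zero controls a decomposition only through its sum. So `v` is placed, together with a
-- complement `c`, over a large pair `e' ≪ e` that differs by at most `s`. A decomposition `z₁ + z₂`
-- pinned between `e'` and `e` has error at most `s`, and cancelling `z₂` moves this precision to
-- `z₁ ≪ v`.
theorem DimLE.exists_wayBelow_add_between (hdim : DimLE S 0) {u v t : S} (huv : WayBelow u v)
    (ht : t ≠ 0) :
    ∃ w' w, WayBelow u w' ∧ WayBelow w' w ∧ WayBelow w v ∧ WayBelow w (w' + t) := by
  by_cases hv : v = 0
  · subst hv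
    have hu : u = 0 := eq_zero_of_le huv.le
    exact ⟨0, 0, hu.symm ▸ zero_wayBelow (0 : S), zero_wayBelow 0, zero_wayBelow 0, zero_wayBelow _⟩
  obtain ⟨τ, hτ0, hτ⟩ := (hsoft v).exists_add_wayBelow hv huv
  obtain ⟨s, hs0, hsτ, hst⟩ := hS.exists_ne_zero_le hO6 hτ0 ht
  obtain ⟨U', hU', hU'v⟩ := (hτ.le_trans (add_le_add le_rfl hsτ)).interpolate
  obtain ⟨U, hU'U, hUv⟩ := hU'v.interpolate
  obtain ⟨e', e, hUe', he'e, hee'⟩ := hS.exists_large_le_add hUv hs0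
  obtain ⟨c, hce, hec, -⟩ := hO5 U' U 0 0 e (by simpa using hUe'.trans he'e.le) hU'U
    (zero_wayBelow 0)
  obtain ⟨e₀, he'e₀, he₀e⟩ := he'e.interpolate
  obtain ⟨z₁, z₂, hz₁, hz₂, hlow, hupp⟩ := hdim.exists_decomposition he'e₀
    (he₀e.trans_le (hec.trans (add_le_add hUv.le le_rfl)))
  obtain ⟨w', hw', hlow'⟩ := hlow.exists_wayBelow_add_left
  have hle : e ≤ w' + s + z₂ := hee'.trans (by
    rw [add_right_comm]
    exact add_le_add hlow'.le le_rfl)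
  refine ⟨w', z₁, ?_, hw', hz₁, ?_⟩
  -- The gap `s` kept between `u` and `U'` pays for the error `s` in `e ≤ w' + s + z₂`.
  · have h₁ : WayBelow (u + s + z₂) (w' + s + z₂) := (hU'.add hz₂).trans_le (hce.trans hle)
    exact hc _ _ s (hc _ _ z₂ h₁)
  · have h₁ : WayBelow (z₁ + z₂) (w' + s + z₂) := (hupp.trans he₀e).trans_le hle
    exact (hc _ _ z₂ h₁).trans_le (add_le_add le_rfl hst)

include hS hsoft hc hO5 hO6 in
theorem DimLE.isSupDense_hasThinBoundary (hdim : DimLE S 0) (hbased : CountablyBased S) :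
    IsSupDense {x : S | HasThinBoundary x} := by
  intro x' x hx
  obtain ⟨t, ht⟩ := hbased.exists_seq
  have step : ∀ (n : ℕ) (p : {p : S × S // WayBelow p.1 p.2}),
      ∃ q : {p : S × S // WayBelow p.1 p.2}, WayBelow p.1.1 q.1.1 ∧ WayBelow q.1.2 p.1.2 ∧
        (t n ≠ 0 → WayBelow q.1.2 (q.1.1 + t n)) := by
    intro n p
    by_cases h0 : t n = 0
    · obtain ⟨w', h₁, h₂⟩ := p.2.interpolate
      obtain ⟨w, h₃, h₄⟩ := h₂.interpolate
      exact ⟨⟨(w', w), h₃⟩, h₁, h₄, fun h => absurd h0 h⟩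
    · obtain ⟨w', w, h₁, h₂, h₃, h₄⟩ :=
        hdim.exists_wayBelow_add_between hS hsoft hc hO5 hO6 p.2 h0
      exact ⟨⟨(w', w), h₂⟩, h₁, h₃, fun _ => h₄⟩
  choose f hf₁ hf₂ hf₃ using step
  let p : ℕ → {p : S × S // WayBelow p.1 p.2} := fun n => Nat.rec ⟨(x', x), hx⟩ f n
  have hlow : ∀ n, WayBelow (p n).1.1 (p (n + 1)).1.1 := fun n => hf₁ n (p n)
  have hupp : Antitone fun n => (p n).1.2 := antitone_nat_of_succ_le fun n => (hf₂ n (p n)).le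
  obtain ⟨b, hb⟩ := IsCuSemigroup.exists_sup (fun n => (p n).1.1) (monotone_of_wayBelow_succ hlow)
  have hbp : ∀ n, b ≤ (p n).1.2 := by
    intro n
    refine hb.2 ?_
    rintro _ ⟨m, rfl⟩
    calc (p m).1.1 ≤ (p (max m n)).1.1 := monotone_of_wayBelow_succ hlow (le_max_left _ _)
      _ ≤ (p (max m n)).1.2 := (p _).2.le
      _ ≤ (p n).1.2 := hupp (le_max_right _ _)
  -- Since `b` lies between all lower and upper ends, the estimate at stage `n` gives `b ≪ b + t n`.
  refine ⟨b, fun s hs => ?_, hb.1 ⟨0, rfl⟩, WayBelow.le_trans (hbp 1) (hf₂ 0 (p 0))⟩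
  obtain ⟨n, hn0, hn⟩ := ht s hs
  exact WayBelow.le_trans (hbp (n + 1)) ((hf₃ n (p n) hn0).trans_le
    (add_le_add (hb.1 ⟨n + 1, rfl⟩) hn))

end ZeroDimensional

/-! ### Complements and Riesz decomposition of thin elements -/

section ThinBoundary

variable {S : Type*} [AddCommMonoid S] [PartialOrder S]

theorem HasThinBoundary.of_add (hc : WeaklyCancellative S) {a b : S}
    (h : HasThinBoundary (a + b)) : HasThinBoundary b := fun t ht =>
  hc.cancel_left (z := a) (by rw [← add_assoc]; exact h t ht)

variable [IsCuSemigroup S]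

theorem HasThinBoundary.zero : HasThinBoundary (0 : S) := fun _ _ => zero_wayBelow _

theorem HasThinBoundary.add (hS : Simple S) (hsoft : Soft S) (hO6 : O6 S) {a b : S}
    (ha : HasThinBoundary a) (hb : HasThinBoundary b) : HasThinBoundary (a + b) := by
  intro t ht
  obtain ⟨s, hs0, hs⟩ := hsoft.exists_two_add_le hS hO6 ht
  refine ((ha s hs0).add (hb s hs0)).trans_le ?_
  rw [add_add_add_comm]
  exact add_le_add le_rfl hs

/-- If `x' + t ≪ x`, then `x' + t ≪ y + t`, and `t` cancels. -/
theorem Soft.le_of_forall_wayBelow_add (hsoft : Soft S) {x y : S}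
    (h : ∀ t, t ≠ 0 → WayBelow x (y + t)) (hc : WeaklyCancellative S) : x ≤ y := by
  by_cases hx : x = 0
  · exact hx ▸ nonneg y
  refine le_of_forall_wayBelow fun x' hx' => ?_
  obtain ⟨t, ht0, ht⟩ := (hsoft x).exists_add_wayBelow hx hx'
  exact (hc _ _ t (ht.trans (h t ht0))).le

/-- An element with thin boundary that is way-below `s` is complemented in `s`. -/
theorem HasThinBoundary.exists_add_eq (hsoft : Soft S) (hc : WeaklyCancellative S) (hO5 : O5 S)
    {a s : S} (ha : HasThinBoundary a) (has : WayBelow a s) : ∃ c, a + c = s := by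
  by_cases hs : s = 0
  · subst hs
    exact ⟨0, by rw [add_zero]; exact eq_zero_of_le has.le⟩
  obtain ⟨u, hu, hus⟩ := IsCuSemigroup.exists_wayBelow_seq s
  have hum := monotone_of_wayBelow_succ hu
  obtain ⟨m, hm⟩ := has.exists_wayBelow_term hum hus
  have approx : ∀ y, WayBelow y s → ∃ z ∈ Set.range (a + ·), y ≤ z ∧ WayBelow z s := by
    intro y hy
    obtain ⟨n, hn⟩ := hy.exists_wayBelow_term hum hus
    have hps := wayBelow_of_isLUB hu hus (max m n)
    have hap : a ≤ u (max m n) := hm.le.trans (hum (le_max_left _ _))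
    have hyp : y ≤ u (max m n) := hn.le.trans (hum (le_max_right _ _))
    obtain ⟨τ, hτ0, hτ⟩ := (hsoft s).exists_add_wayBelow hs hps
    obtain ⟨z, hz, hzs⟩ := hτ.interpolate
    -- Thinness gives `a ≪ a + τ`, so (O5) yields `a + c ≤ z ≤ a + τ + c`. As `z` also exceeds `u
    -- (max m n) + τ`, the error `τ` cancels, and the elements `a + c` are cofinal below `s`.
    obtain ⟨c, hcz, hzc, -⟩ := hO5 a (a + τ) 0 0 z
      (by rw [add_zero]; exact (add_le_add hap le_rfl).trans hz.le) (ha τ hτ0) (zero_wayBelow 0)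
    refine ⟨a + c, ⟨c, rfl⟩, hyp.trans (hc _ _ τ ?_).le, WayBelow.le_trans hcz hzs⟩
    rw [add_right_comm]
    exact hz.trans_le hzc
  obtain ⟨d, hd, hdd, hds⟩ := exists_wayBelow_seq_mem approx
  choose c hcd using hd
  obtain rfl : (fun n => a + c n) = d := funext hcd
  have hcc : ∀ n, WayBelow (c n) (c (n + 1)) := fun n => hc.cancel_left (hdd n)
  obtain ⟨r, hr⟩ := IsCuSemigroup.exists_sup c (monotone_of_wayBelow_succ hcc)
  exact ⟨r, (isLUB_const_add a (monotone_of_wayBelow_succ hcc) hr).unique hds⟩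

/-- (O6) only covers an approximation of `b`. Take a thin `d` under the first piece and its exact
complement in `b`; room `t` reserved inside `z` absorbs what the approximation misses. -/
theorem HasThinBoundary.exists_add_eq_of_wayBelow_add
    (hdense : IsSupDense {x : S | HasThinBoundary x}) (hsoft : Soft S)
    (hc : WeaklyCancellative S) (hO5 : O5 S) (hO6 : O6 S) {b y z : S} (hb : HasThinBoundary b)
    (h : WayBelow b (y + z)) :
    ∃ b₁ b₂, HasThinBoundary b₁ ∧ HasThinBoundary b₂ ∧ b₁ + b₂ = b ∧ WayBelow b₁ y ∧
      WayBelow b₂ z := by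
  by_cases hz : z = 0
  · subst hz
    exact ⟨b, 0, hb, .zero, add_zero b, by simpa using h, zero_wayBelow 0⟩
  obtain ⟨y', z', hy', hz', hle⟩ := exists_le_add_of_wayBelow_add h
  obtain ⟨t, ht0, ht⟩ := (hsoft z).exists_add_wayBelow hz hz'
  -- Thinness of `b` gives `x ≪ b` with `b ≪ x + t`, so covering `x` costs only `t`.
  obtain ⟨x, hxb, hbx⟩ := (hb t ht0).exists_wayBelow_add_left
  obtain ⟨x₁, hxx₁, hx₁⟩ := hxb.interpolate
  obtain ⟨v, w, hvb, hvy, -, hwz, hx₁vw⟩ := hO6 x₁ b y' z' hx₁ hle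
  obtain ⟨v', hv', hxv'⟩ := (hxx₁.trans_le hx₁vw).exists_wayBelow_add_left
  obtain ⟨d, hd, hv'd, hdv⟩ := hdense v' v hv'
  obtain ⟨e, rfl⟩ := hd.exists_add_eq hsoft hc hO5 (hdv.trans_le hvb)
  refine ⟨d, e, hd, hb.of_add hc, rfl, hdv.trans_le (hvy.trans hy'.le), ?_⟩
  have h₁ : WayBelow (d + e) (d + (w + t)) := hbx.trans_le (by
    rw [← add_assoc]
    exact add_le_add (hxv'.le.trans (add_le_add hv'd le_rfl)) le_rfl)
  exact (hc.cancel_left h₁).trans ((ht.le_trans (add_le_add hwz le_rfl)))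

theorem HasThinBoundary.exists_sum_eq_of_wayBelow_sum
    (hdense : IsSupDense {x : S | HasThinBoundary x}) (hsoft : Soft S)
    (hc : WeaklyCancellative S) (hO5 : O5 S) (hO6 : O6 S) (r : ℕ) :
    ∀ (y : Fin r → S) {b : S}, HasThinBoundary b → WayBelow b (∑ j, y j) →
      ∃ z : Fin r → S, (∀ j, WayBelow (z j) (y j)) ∧ ∑ j, z j = b := by
  induction r with
  | zero =>
    intro y b _ h
    exact ⟨0, fun j => j.elim0, by simpa using (eq_zero_of_le (by simpa using h.le)).symm⟩
  | succ r ih =>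
    intro y b hb h
    rw [Fin.sum_univ_succ] at h
    obtain ⟨b₁, b₂, -, hb₂, rfl, h₁, h₂⟩ :=
      hb.exists_add_eq_of_wayBelow_add hdense hsoft hc hO5 hO6 h
    obtain ⟨z, hz, rfl⟩ := ih _ hb₂ h₂
    refine ⟨Fin.cons b₁ z, fun j => ?_, by simp [Fin.sum_univ_succ]⟩
    refine Fin.cases ?_ (fun i => ?_) j
    · simpa using h₁
    · simpa using hz i

theorem dimLE_zero_of_isSupDense (hdense : IsSupDense {x : S | HasThinBoundary x})
    (hsoft : Soft S) (hc : WeaklyCancellative S) (hO5 : O5 S) (hO6 : O6 S) : DimLE S 0 := by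
  intro x' x r y hx hxy
  obtain ⟨x₁, hx'x₁, hx₁⟩ := hx.interpolate
  obtain ⟨b, hb, hx₁b, hbx⟩ := hdense x₁ x hx₁
  obtain ⟨z, hz, hzb⟩ := HasThinBoundary.exists_sum_eq_of_wayBelow_sum hdense hsoft hc hO5 hO6 r y
    hb (hbx.trans hxy)
  refine ⟨fun j _ => z j, fun j _ => hz j, ?_, fun _ => ?_⟩
  · simpa [hzb] using hx'x₁.trans_le hx₁b
  · simpa [hzb] using hbx

end ThinBoundary

/-! ### Countable closures under ternary operations -/

section CountableClosure

variable {S : Type*}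

theorem exists_countable_closed (F : S → S → S → Set S) (hF : ∀ x y z, (F x y z).Countable)
    {D B : Set S} (hD : D.Countable) (hDB : D ⊆ B)
    (hB : ∀ x ∈ B, ∀ y ∈ B, ∀ z ∈ B, F x y z ⊆ B) :
    ∃ M : Set S, M.Countable ∧ D ⊆ M ∧ M ⊆ B ∧ ∀ x ∈ M, ∀ y ∈ M, ∀ z ∈ M, F x y z ⊆ M := by
  let G : Set S → Set S := fun A => A ∪ ⋃ x ∈ A, ⋃ y ∈ A, ⋃ z ∈ A, F x y z
  let A : ℕ → Set S := fun n => G^[n] D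
  have hsucc : ∀ n, A (n + 1) = G (A n) := fun n => Function.iterate_succ_apply' G n D
  have hmono : Monotone A := monotone_nat_of_le_succ fun n => by
    rw [hsucc]; exact Set.subset_union_left
  refine ⟨⋃ n, A n, Set.countable_iUnion fun n => ?_, Set.subset_iUnion A 0,
    Set.iUnion_subset fun n => ?_, fun x hx y hy z hz => ?_⟩
  · induction n with
    | zero => exact hD
    | succ n ih =>
      rw [hsucc]
      exact ih.union (ih.biUnion fun x _ => ih.biUnion fun y _ => ih.biUnion fun z _ => hF x y z)
  · induction n with
    | zero => exact hDB
    | succ n ih =>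
      rw [hsucc]
      exact Set.union_subset ih (Set.iUnion₂_subset fun x hx => Set.iUnion₂_subset fun y hy =>
        Set.iUnion₂_subset fun z hz => hB x (ih hx) y (ih hy) z (ih hz))
  · obtain ⟨i, hi⟩ := Set.mem_iUnion.1 hx
    obtain ⟨j, hj⟩ := Set.mem_iUnion.1 hy
    obtain ⟨k, hk⟩ := Set.mem_iUnion.1 hz
    let n := max i (max j k)
    refine Set.Subset.trans ?_ (Set.subset_iUnion A (n + 1))
    rw [hsucc]
    refine Set.Subset.trans ?_ Set.subset_union_right
    exact Set.subset_biUnion_of_mem (u := fun x => ⋃ y ∈ A n, ⋃ z ∈ A n, F x y z)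
        (hmono (by omega) hi) |>.trans' <|
      Set.subset_biUnion_of_mem (u := fun y => ⋃ z ∈ A n, F x y z)
          (hmono (by omega) hj) |>.trans' <|
      Set.subset_biUnion_of_mem (u := fun z => F x y z) (hmono (by omega) hk)

end CountableClosure

/-! ### The countable core of thin elements -/

section CompactCore

variable (S : Type*) [AddCommMonoid S] [PartialOrder S]

/-- A countable, sup-dense submonoid of elements with thin boundary in a soft, weakly cancellative
semigroup `S` that is closed under complements and has Riesz decompositions. Its elements become
the compact elements of an algebraic `Cu`-semigroup with soft part `S`. -/
structure CompactCore where
  soft : Soft S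
  cancel : WeaklyCancellative S
  /-- The underlying submonoid. -/
  carrier : AddSubmonoid S
  countable : (carrier : Set S).Countable
  isSupDense : IsSupDense (carrier : Set S)
  thin : ∀ a ∈ carrier, HasThinBoundary a
  exists_add_eq : ∀ a ∈ carrier, ∀ b ∈ carrier, WayBelow a b → ∃ c ∈ carrier, a + c = b
  exists_add_eq_of_wayBelow_add : ∀ a ∈ carrier, ∀ y ∈ carrier, ∀ z ∈ carrier,
    WayBelow a (y + z) → ∃ v ∈ carrier, ∃ w ∈ carrier, v + w = a ∧ WayBelow v y ∧ WayBelow w z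

variable {S} [IsCuSemigroup S]

theorem CountablyBased.exists_countable_subset (h : CountablyBased S) {B : Set S}
    (hB : IsSupDense B) : ∃ D ⊆ B, D.Countable ∧ IsSupDense D := by
  obtain ⟨E, hE, hdense⟩ := h
  have hex : ∀ p : {p : S × S // p.1 ∈ E ∧ p.2 ∈ E ∧ WayBelow p.1 p.2},
      ∃ b ∈ B, p.1.1 ≤ b ∧ WayBelow b p.1.2 := fun p => hB _ _ p.2.2.2
  choose f hfB hf hf' using hex
  have hcount : {p : S × S | p.1 ∈ E ∧ p.2 ∈ E ∧ WayBelow p.1 p.2}.Countable :=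
    Set.Countable.mono (s₂ := E ×ˢ E) (fun p hp => Set.mk_mem_prod hp.1 hp.2.1) (hE.prod hE)
  have : Countable {p : S × S // p.1 ∈ E ∧ p.2 ∈ E ∧ WayBelow p.1 p.2} := hcount.to_subtype
  refine ⟨Set.range f, Set.range_subset_iff.2 hfB, Set.countable_range f, fun x' x hx => ?_⟩
  obtain ⟨x₁, hx', hx₁⟩ := hx.interpolate
  obtain ⟨d, hd, hx'd, hdx₁⟩ := hdense x' x₁ hx'
  obtain ⟨d', hd', hx₁d', hd'x⟩ := hdense x₁ x hx₁
  let p : {p : S × S // p.1 ∈ E ∧ p.2 ∈ E ∧ WayBelow p.1 p.2} :=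
    ⟨(d, d'), hd, hd', hdx₁.trans_le hx₁d'⟩
  exact ⟨f p, ⟨p, rfl⟩, hx'd.trans (hf p), (hf' p).trans hd'x⟩

theorem exists_compactCore (hbased : CountablyBased S) (hS : Simple S) (hsoft : Soft S)
    (hc : WeaklyCancellative S) (hO5 : O5 S) (hO6 : O6 S)
    (hdense : IsSupDense {x : S | HasThinBoundary x}) : Nonempty (CompactCore S) := by
  obtain ⟨D, hDB, hD, hDdense⟩ := hbased.exists_countable_subset hdense
  have hcompl : ∀ a b : S, ∃ c : S, HasThinBoundary a → HasThinBoundary b → WayBelow a b →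
      HasThinBoundary c ∧ a + c = b := by
    intro a b
    by_cases h : HasThinBoundary a ∧ HasThinBoundary b ∧ WayBelow a b
    · obtain ⟨c, rfl⟩ := h.1.exists_add_eq hsoft hc hO5 h.2.2
      exact ⟨c, fun _ hb _ => ⟨hb.of_add hc, rfl⟩⟩
    · exact ⟨0, fun h₁ h₂ h₃ => absurd ⟨h₁, h₂, h₃⟩ h⟩
  have hdec : ∀ a y z : S, ∃ v w : S, HasThinBoundary a → WayBelow a (y + z) →
      HasThinBoundary v ∧ HasThinBoundary w ∧ v + w = a ∧ WayBelow v y ∧ WayBelow w z := by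
    intro a y z
    by_cases h : HasThinBoundary a ∧ WayBelow a (y + z)
    · obtain ⟨v, w, hvw⟩ := h.1.exists_add_eq_of_wayBelow_add hdense hsoft hc hO5 hO6 h.2
      exact ⟨v, w, fun _ _ => hvw⟩
    · exact ⟨0, 0, fun h₁ h₂ => absurd ⟨h₁, h₂⟩ h⟩
  choose r hr using hcompl
  choose v w hvw using hdec
  -- The guards keep the closure inside the thin elements: off their domains the chosen `r`, `v`,
  -- `w` are arbitrary.
  let F : S → S → S → Set S := fun x y z =>
    {p | p = x + y ∨ (WayBelow x y ∧ p = r x y) ∨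
      (WayBelow x (y + z) ∧ (p = v x y z ∨ p = w x y z))}
  have hF : ∀ x y z, (F x y z).Countable := fun x y z =>
    (Set.toFinite {x + y, r x y, v x y z, w x y z}).countable.mono (by
      intro p hp
      simp only [Set.mem_insert_iff, Set.mem_singleton_iff]
      rcases hp with h | ⟨-, h⟩ | ⟨-, h | h⟩ <;> simp [h])
  obtain ⟨M, hM, hDM, hMB, hMF⟩ := exists_countable_closed F hF (D := insert 0 D)
    (B := {x : S | HasThinBoundary x}) (hD.insert 0)
    (Set.insert_subset HasThinBoundary.zero hDB) (by
      rintro x hx y hy z hz p (rfl | ⟨h, rfl⟩ | ⟨h, rfl | rfl⟩)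
      · exact HasThinBoundary.add hS hsoft hO6 hx hy
      · exact (hr x y hx hy h).1
      · exact (hvw x y z hx h).1
      · exact (hvw x y z hx h).2.1)
  refine ⟨⟨hsoft, hc, ⟨⟨M, fun {a b} ha hb => hMF a ha b hb a ha (Or.inl rfl)⟩,
    hDM (Set.mem_insert 0 D)⟩, hM, fun x' x hx => ?_, fun a ha => hMB ha, ?_, ?_⟩⟩
  · obtain ⟨d, hd, h⟩ := hDdense x' x hx
    exact ⟨d, hDM (Set.mem_insert_of_mem 0 hd), h⟩
  · intro a ha b hb hab
    exact ⟨r a b, hMF a ha b hb a ha (Or.inr (Or.inl ⟨hab, rfl⟩)), (hr a b (hMB ha) (hMB hb) hab).2⟩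
  · intro a ha y hy z hz h
    exact ⟨v a y z, hMF a ha y hy z hz (Or.inr (Or.inr ⟨h, Or.inl rfl⟩)), w a y z,
      hMF a ha y hy z hz (Or.inr (Or.inr ⟨h, Or.inr rfl⟩)), (hvw a y z (hMB ha) h).2.2⟩

end CompactCore

/-! ### The algebraic extension: order, addition and suprema -/

variable {S : Type*} [AddCommMonoid S] [PartialOrder S]

/-- The algebraic semigroup with set of compact elements `C.carrier` and soft part `S`: an element
of `S` together with a tag that says whether it is regarded as compact. -/
@[ext]
structure CompactCore.Ext (C : CompactCore S) where
  /-- The underlying element of `S`. -/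
  val : S
  /-- Whether the element is compact. -/
  cpt : Prop
  mem : cpt → val ∈ C.carrier
  ne_zero : ¬ cpt → val ≠ 0

namespace CompactCore.Ext

variable {C : CompactCore S}

instance : Zero C.Ext := ⟨⟨0, True, fun _ => C.carrier.zero_mem, fun h => absurd trivial h⟩⟩

@[simp] theorem val_zero : (0 : C.Ext).val = 0 := rfl
@[simp] theorem cpt_zero : (0 : C.Ext).cpt = True := rfl

theorem cpt_of_val_eq_zero {p : C.Ext} (h : p.val = 0) : p.cpt :=
  by_contra fun hp => p.ne_zero hp h

theorem eq_of_cpt {p q : C.Ext} (hp : p.cpt) (hq : q.cpt) (h : p.val = q.val) : p = q :=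
  Ext.ext h (propext ⟨fun _ => hq, fun _ => hp⟩)

theorem eq_of_not_cpt {p q : C.Ext} (hp : ¬ p.cpt) (hq : ¬ q.cpt) (h : p.val = q.val) : p = q :=
  Ext.ext h (propext ⟨fun h => absurd h hp, fun h => absurd h hq⟩)

instance : LE C.Ext := ⟨fun p q => p = q ∨ WayBelow p.val q.val ∨ (¬ p.cpt ∧ p.val ≤ q.val)⟩

theorem le_of_wayBelow {p q : C.Ext} (h : WayBelow p.val q.val) : p ≤ q := Or.inr (Or.inl h)

theorem le_of_not_cpt {p q : C.Ext} (hp : ¬ p.cpt) (h : p.val ≤ q.val) : p ≤ q :=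
  Or.inr (Or.inr ⟨hp, h⟩)

theorem eq_zero_of_val_eq_zero {p : C.Ext} (h : p.val = 0) : p = 0 :=
  eq_of_cpt (cpt_of_val_eq_zero h) trivial h

theorem val_le {p q : C.Ext} (h : p ≤ q) : p.val ≤ q.val := by
  rcases h with rfl | h | h
  exacts [le_rfl, h.le, h.2]

theorem eq_or_wayBelow {p q : C.Ext} (hp : p.cpt) (h : p ≤ q) : p = q ∨ WayBelow p.val q.val := by
  rcases h with h | h | h
  exacts [Or.inl h, Or.inr h, absurd hp h.1]

variable [IsCuSemigroup S]

instance : Add C.Ext := ⟨fun p q => ⟨p.val + q.val, p.cpt ∧ q.cpt,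
  fun h => C.carrier.add_mem (p.mem h.1) (q.mem h.2), fun h h0 => h
    ⟨by_contra fun hp => p.ne_zero hp (add_eq_zero_left h0),
      by_contra fun hq => q.ne_zero hq (add_eq_zero_right h0)⟩⟩⟩

@[simp] theorem val_add (p q : C.Ext) : (p + q).val = p.val + q.val := rfl
@[simp] theorem cpt_add (p q : C.Ext) : (p + q).cpt = (p.cpt ∧ q.cpt) := rfl

instance : AddCommMonoid C.Ext where
  add_assoc p q r := Ext.ext (add_assoc _ _ _) (propext and_assoc)
  zero_add p := Ext.ext (zero_add _) (by simp)
  add_zero p := Ext.ext (add_zero _) (by simp)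
  add_comm p q := Ext.ext (add_comm _ _) (propext and_comm)
  nsmul := nsmulRec

@[simp] theorem val_nsmul (n : ℕ) (p : C.Ext) : (n • p).val = n • p.val := by
  induction n with
  | zero => simp
  | succ n ih => rw [succ_nsmul, succ_nsmul, val_add, ih]

theorem eq_zero_of_wayBelow_self {x : S} (C : CompactCore S) (h : WayBelow x x) : x = 0 :=
  (C.soft x).eq_zero_of_isCompactElt C.cancel h

instance : PartialOrder C.Ext where
  le_refl p := Or.inl rfl
  le_trans p q r hpq hqr := by
    rcases hpq with rfl | h | h
    · exact hqr
    · exact le_of_wayBelow (h.trans_le (val_le hqr))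
    · exact le_of_not_cpt h.1 (h.2.trans (val_le hqr))
  le_antisymm p q hpq hqp := by
    have hval := le_antisymm (val_le hpq) (val_le hqp)
    have key : WayBelow p.val p.val → p = q := fun h => by
      have h0 := eq_zero_of_wayBelow_self C h
      rw [eq_zero_of_val_eq_zero h0, eq_zero_of_val_eq_zero (hval.symm.trans h0)]
    rcases hpq with h | h | h
    · exact h
    · exact key (by rwa [← hval] at h)
    rcases hqp with h' | h' | h'
    · exact h'.symm
    · exact key (by rwa [← hval] at h')
    · exact eq_of_not_cpt h.1 h'.1 hval

theorem val_mono {u : ℕ → C.Ext} (hu : Monotone u) : Monotone fun n => (u n).val :=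
  fun _ _ h => val_le (hu h)

theorem zero_le (p : C.Ext) : 0 ≤ p := le_of_wayBelow (zero_wayBelow _)

/-- For compact sums, `p ≪ q` must give `p + r ≪ q + r`, although `r ≪ r` fails in `S` unless `r =
0`. Softness gives `p + t ≤ q`, and thinness of `p + r` gives `p + r ≪ p + r + t`. -/
theorem add_le_add_right' {p q : C.Ext} (h : p ≤ q) (r : C.Ext) : p + r ≤ q + r := by
  by_cases hp : (p + r).cpt
  · rcases eq_or_wayBelow hp.1 h with rfl | h
    · exact Or.inl rfl
    by_cases hq : q.val = 0
    · have hp0 : p.val = 0 := eq_zero_of_le (hq ▸ h.le)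
      rw [eq_zero_of_val_eq_zero hq, eq_zero_of_val_eq_zero hp0]
    obtain ⟨t, ht0, ht⟩ := (C.soft q.val).exists_add_wayBelow hq h
    refine le_of_wayBelow ((C.thin _ ((p + r).mem hp) t ht0).trans_le ?_)
    rw [val_add, add_right_comm]
    exact add_le_add ht.le le_rfl
  · exact le_of_not_cpt hp (add_le_add (val_le h) le_rfl)

/-- A sequence that is not eventually constant has the supremum computed in `S` as a noncompact
supremum. -/
theorem exists_isLUB_of_not_stable {u : ℕ → C.Ext} (hu : Monotone u)
    (h : ∀ n, ∃ m, n ≤ m ∧ u m ≠ u n) {s : S} (hs : IsLUB (Set.range fun n => (u n).val) s) :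
    ∃ p : C.Ext, p.val = s ∧ ¬ p.cpt ∧ IsLUB (Set.range u) p := by
  have hs0 : s ≠ 0 := by
    rintro rfl
    have hz : ∀ n, u n = 0 := fun n => eq_zero_of_val_eq_zero (eq_zero_of_le (hs.1 ⟨n, rfl⟩))
    obtain ⟨m, -, hm⟩ := h 0
    exact hm (by rw [hz, hz])
  refine ⟨⟨s, False, False.elim, fun _ => hs0⟩, rfl, id, ?_, fun w hw => ?_⟩
  · rintro _ ⟨n, rfl⟩
    obtain ⟨m, hnm, hm⟩ := h n
    have hms : (u m).val ≤ s := hs.1 ⟨m, rfl⟩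
    rcases hu hnm with h | h | h
    · exact absurd h.symm hm
    · exact le_of_wayBelow (h.trans_le hms)
    · exact le_of_not_cpt h.1 (h.2.trans hms)
  · refine le_of_not_cpt id (hs.2 ?_)
    rintro _ ⟨n, rfl⟩
    exact val_le (hw ⟨n, rfl⟩)

theorem isLUB_of_stable {α : Type*} [PartialOrder α] {u : ℕ → α} (hu : Monotone u) {n : ℕ}
    (h : ∀ m, n ≤ m → u m = u n) : IsLUB (Set.range u) (u n) := by
  refine ⟨?_, fun w hw => hw ⟨n, rfl⟩⟩
  rintro _ ⟨m, rfl⟩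
  exact (hu (le_max_left m n)).trans (h _ (le_max_right m n)).le

theorem isLUB_val {u : ℕ → C.Ext} (hu : Monotone u) {p : C.Ext} (hp : IsLUB (Set.range u) p) :
    IsLUB (Set.range fun n => (u n).val) p.val := by
  by_cases h : ∃ n, ∀ m, n ≤ m → u m = u n
  · obtain ⟨n, hn⟩ := h
    obtain rfl := (isLUB_of_stable hu hn).unique hp
    exact isLUB_of_stable (val_mono hu) fun m hm => by rw [hn m hm]
  · push Not at h
    obtain ⟨s, hs⟩ := IsCuSemigroup.exists_sup _ (val_mono hu)
    obtain ⟨q, rfl, -, hq⟩ := exists_isLUB_of_not_stable hu h hs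
    rwa [← hq.unique hp]

/-- A sequence that never stabilizes has a noncompact supremum; hence tagged elements really are
compact. -/
theorem exists_eq_of_isLUB {u : ℕ → C.Ext} (hu : Monotone u) {p : C.Ext}
    (hp : IsLUB (Set.range u) p) (hcpt : p.cpt) : ∃ n, u n = p := by
  by_cases h : ∃ n, ∀ m, n ≤ m → u m = u n
  · obtain ⟨n, hn⟩ := h
    exact ⟨n, (isLUB_of_stable hu hn).unique hp⟩
  · push Not at h
    obtain ⟨q, -, hq, hqu⟩ := exists_isLUB_of_not_stable hu h (isLUB_val hu hp)
    exact absurd (hqu.unique hp ▸ hcpt) hq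

theorem wayBelow_of_val {p q : C.Ext} (h : WayBelow p.val q.val) : WayBelow p q := by
  intro u hu s hs hq
  obtain ⟨n, hn⟩ := (h.trans_le (val_le hq)).exists_wayBelow_term (val_mono hu) (isLUB_val hu hs)
  exact ⟨n, le_of_wayBelow hn⟩

theorem isCompactElt_of_cpt {p : C.Ext} (hp : p.cpt) : IsCompactElt p := by
  intro u hu s hs hps
  by_cases hcpt : s.cpt
  · obtain ⟨n, rfl⟩ := exists_eq_of_isLUB hu hs hcpt
    exact ⟨n, hps⟩
  · rcases eq_or_wayBelow hp hps with rfl | h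
    · exact absurd hp hcpt
    · exact wayBelow_of_val h u hu s hs le_rfl

/-- The compact element attached to an element of the core. -/
def ofMem {x : S} (hx : x ∈ C.carrier) : C.Ext := ⟨x, True, fun _ => hx, fun h => absurd trivial h⟩

theorem exists_cpt_seq (p : C.Ext) :
    ∃ u : ℕ → C.Ext, (∀ n, (u n).cpt) ∧ (∀ n, WayBelow (u n) (u (n + 1))) ∧
      IsLUB (Set.range u) p := by
  by_cases hp : p.cpt
  · exact ⟨fun _ => p, fun _ => hp, fun _ => isCompactElt_of_cpt hp, by simp⟩
  · obtain ⟨d, hd, hdd, hdp⟩ := C.isSupDense.exists_wayBelow_seq p.val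
    refine ⟨fun n => ofMem (hd n), fun _ => trivial, fun n => wayBelow_of_val (hdd n), ?_, ?_⟩
    · rintro _ ⟨n, rfl⟩
      exact le_of_wayBelow (wayBelow_of_isLUB hdd hdp n)
    · intro w hw
      refine le_of_not_cpt hp (hdp.2 ?_)
      rintro _ ⟨n, rfl⟩
      exact val_le (hw ⟨n, rfl⟩)

theorem exists_cpt_between {p q : C.Ext} (h : WayBelow p q) :
    ∃ c : C.Ext, c.cpt ∧ p ≤ c ∧ c ≤ q := by
  obtain ⟨u, hu, huu, huq⟩ := exists_cpt_seq q
  obtain ⟨n, hn⟩ := h u (monotone_of_wayBelow_succ huu) q huq le_rfl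
  exact ⟨u n, hu n, hn, huq.1 ⟨n, rfl⟩⟩

instance : IsOrderedAddMonoid C.Ext where
  add_le_add_left _ _ h r := add_le_add_right' h r

instance : IsCuSemigroup C.Ext where
  zero_le := zero_le
  exists_sup u hu := by
    by_cases h : ∃ n, ∀ m, n ≤ m → u m = u n
    · obtain ⟨n, hn⟩ := h
      exact ⟨u n, isLUB_of_stable hu hn⟩
    · push Not at h
      obtain ⟨s, hs⟩ := IsCuSemigroup.exists_sup _ (val_mono hu)
      obtain ⟨q, -, -, hq⟩ := exists_isLUB_of_not_stable hu h hs
      exact ⟨q, hq⟩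
  exists_wayBelow_seq p := by
    obtain ⟨u, -, h⟩ := exists_cpt_seq p
    exact ⟨u, h⟩
  wayBelow_add x' x y' y hx hy := by
    obtain ⟨c, hc, hxc, hcx⟩ := exists_cpt_between hx
    obtain ⟨d, hd, hyd, hdy⟩ := exists_cpt_between hy
    exact WayBelow.le_trans (add_le_add hxc hyd)
      (WayBelow.trans_le (isCompactElt_of_cpt (p := c + d) ⟨hc, hd⟩) (add_le_add hcx hdy))
  sup_add u v hu hv a b ha hb := by
    refine ⟨?_, fun w hw => ?_⟩
    · rintro _ ⟨n, rfl⟩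
      exact add_le_add (ha.1 ⟨n, rfl⟩) (hb.1 ⟨n, rfl⟩)
    by_cases hab : (a + b).cpt
    · obtain ⟨m, hm⟩ := exists_eq_of_isLUB hu ha hab.1
      obtain ⟨n, hn⟩ := exists_eq_of_isLUB hv hb hab.2
      refine le_trans (add_le_add ?_ ?_) (hw ⟨max m n, rfl⟩)
      · exact hm ▸ hu (le_max_left m n)
      · exact hn ▸ hv (le_max_right m n)
    · refine le_of_not_cpt hab ((IsCuSemigroup.sup_add _ _ (val_mono hu) (val_mono hv) _ _
        (isLUB_val hu ha) (isLUB_val hv hb)).2 ?_)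
      rintro _ ⟨n, rfl⟩
      exact val_le (hw ⟨n, rfl⟩)

/-! ### Axioms for the extension, and its soft part -/

theorem algebraic : Algebraic C.Ext := by
  intro p q h
  obtain ⟨c, hc, hpc, hcq⟩ := exists_cpt_between h
  exact ⟨c, isCompactElt_of_cpt hc, hpc, (isCompactElt_of_cpt hc).trans_le hcq⟩

theorem countablyBased : CountablyBased C.Ext := by
  refine ⟨{p | p.cpt}, ?_, fun p q h => ?_⟩
  · refine Set.MapsTo.countable_of_injOn (f := val) (t := (C.carrier : Set S))
      (fun p hp => p.mem hp) (fun _ hp _ hq h => eq_of_cpt hp hq h) C.countable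
  · obtain ⟨c, hc, hpc, hcq⟩ := exists_cpt_between h
    exact ⟨c, hc, hpc, (isCompactElt_of_cpt hc).trans_le hcq⟩

theorem simple (hS : Simple S) : Simple C.Ext := by
  intro I hI
  refine I.bot_or_exists_ne_zero.imp_right ?_
  rintro ⟨p, hp, hp0⟩
  have hpv : p.val ≠ 0 := fun h => hp0 (eq_zero_of_val_eq_zero h)
  have hcpt : ∀ c : C.Ext, c.cpt → c ∈ I := by
    intro c hc
    have hthin := C.thin _ (c.mem hc) _ hpv
    obtain ⟨n, hn⟩ := hS.exists_le_nsmul hpv hthin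
    refine hI.1 c ((n + 1) • p) (le_of_wayBelow ?_) (I.nsmul_mem hp _)
    rw [val_nsmul, succ_nsmul]
    exact hthin.trans_le (add_le_add hn le_rfl)
  refine eq_top_iff.2 fun q _ => ?_
  obtain ⟨u, hu, huu, huq⟩ := exists_cpt_seq q
  exact hI.2 u (monotone_of_wayBelow_succ huu) (fun n => hcpt _ (hu n)) q huq

theorem weaklyCancellative : WeaklyCancellative C.Ext := by
  intro x y z h
  have key : ∀ a ∈ C.carrier, x.val + z.val ≤ a → a ≤ y.val + z.val → y.val ∈ C.carrier →
      z.val ∈ C.carrier → x.val ≤ y.val := by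
    intro a ha hxa hay hy hz
    refine C.soft.le_of_forall_wayBelow_add (fun t ht => C.cancel _ _ z.val ?_) C.cancel
    rw [add_right_comm]
    exact WayBelow.le_trans (hxa.trans hay) (C.thin _ (C.carrier.add_mem hy hz) t ht)
  obtain ⟨c, hc, hxc, hcy⟩ := exists_cpt_between h
  rcases eq_or_wayBelow hc hcy with rfl | hwb
  · have hle := key _ ((y + z).mem hc) (val_le hxc) le_rfl (y.mem hc.1) (z.mem hc.2)
    by_cases hx : x.cpt
    · rcases eq_or_wayBelow (p := x + z) ⟨hx, hc.2⟩ hxc with heq | hwb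
      · have hval : x.val + z.val = y.val + z.val := congrArg val heq
        have hge : y.val ≤ x.val := by
          refine C.soft.le_of_forall_wayBelow_add (fun t ht => C.cancel _ _ z.val ?_) C.cancel
          rw [add_right_comm, hval]
          exact C.thin _ ((y + z).mem hc) t ht
        rw [eq_of_cpt hx hc.1 (le_antisymm hle hge)]
        exact isCompactElt_of_cpt hc.1
      · exact wayBelow_of_val (C.cancel _ _ z.val hwb)
    · exact WayBelow.le_trans (le_of_not_cpt hx hle) (isCompactElt_of_cpt hc.1)
  · exact wayBelow_of_val (C.cancel _ _ z.val (WayBelow.le_trans (val_le hxc) hwb))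

theorem exists_add_eq_of_cpt (hO5 : O5 S) {a z : C.Ext} (ha : a.cpt) (h : a ≤ z) :
    ∃ c, a + c = z := by
  rcases eq_or_wayBelow ha h with rfl | h
  · exact ⟨0, add_zero a⟩
  by_cases hz : z.cpt
  · obtain ⟨c, hc, hac⟩ := C.exists_add_eq _ (a.mem ha) _ (z.mem hz) h
    exact ⟨ofMem hc, eq_of_cpt ⟨ha, trivial⟩ hz hac⟩
  · obtain ⟨c, hc⟩ := (C.thin _ (a.mem ha)).exists_add_eq C.soft C.cancel hO5 h
    have hc0 : c ≠ 0 := by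
      rintro rfl
      rw [add_zero] at hc
      rw [hc] at h
      exact z.ne_zero hz (eq_zero_of_wayBelow_self C h)
    exact ⟨⟨c, False, False.elim, fun _ => hc0⟩, eq_of_not_cpt (fun h => h.2) hz hc⟩

theorem o5 (hO5 : O5 S) : O5 C.Ext := by
  intro x' x y' y z hxyz hx hy
  obtain ⟨a, ha, hxa, hax⟩ := exists_cpt_between hx
  obtain ⟨b, hb, hyb, hby⟩ := exists_cpt_between hy
  -- Complementing `a + b` rather than `a` forces the complement `b + c` of `a` to dominate `b`.
  obtain ⟨c, rfl⟩ := exists_add_eq_of_cpt hO5 (a := a + b) ⟨ha, hb⟩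
    ((add_le_add hax hby).trans hxyz)
  rw [add_assoc]
  exact ⟨b + c, add_le_add hxa le_rfl, add_le_add hax le_rfl,
    (WayBelow.le_trans hyb (isCompactElt_of_cpt hb)).trans_le (le_self_add b c)⟩

theorem exists_cpt_add_of_le {a y z : C.Ext} (ha : a.cpt) (h : a ≤ y + z) :
    ∃ b c : C.Ext, b.cpt ∧ c.cpt ∧ b ≤ y ∧ c ≤ z ∧ a ≤ b + c := by
  obtain ⟨y', z', hy', hz', hle⟩ :=
    exists_le_add_of_wayBelow_add ((isCompactElt_of_cpt ha).trans_le h)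
  obtain ⟨b, hb, hyb, hby⟩ := exists_cpt_between hy'
  obtain ⟨c, hc, hzc, hcz⟩ := exists_cpt_between hz'
  exact ⟨b, c, hb, hc, hby, hcz, hle.trans (add_le_add hyb hzc)⟩

theorem o6 : O6 C.Ext := by
  intro x' x y z hx hxyz
  obtain ⟨a, ha, hxa, hax⟩ := exists_cpt_between hx
  obtain ⟨b, c, hb, hc, hby, hcz, hle⟩ := exists_cpt_add_of_le ha (hax.trans hxyz)
  rcases eq_or_wayBelow ha hle with rfl | hwb
  · exact ⟨b, c, (le_self_add b c).trans hax, hby, (le_add_self c b).trans hax, hcz, hxa⟩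
  · obtain ⟨v, hv, w, hw, hvw, hvb, hwc⟩ :=
      C.exists_add_eq_of_wayBelow_add _ (a.mem ha) _ (b.mem hb) _ (c.mem hc) hwb
    obtain rfl : ofMem hv + ofMem hw = a := eq_of_cpt ⟨trivial, trivial⟩ ha hvw
    exact ⟨ofMem hv, ofMem hw, (le_self_add _ _).trans hax, (le_of_wayBelow hvb).trans hby,
      (le_add_self _ _).trans hax, (le_of_wayBelow hwc).trans hcz, hxa⟩

/-- The embedding of `S` as the soft part. -/
def ofSoft (x : S) : C.Ext :=
  ⟨x, x = 0, fun h => h ▸ C.carrier.zero_mem, id⟩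

theorem ofSoft_le_ofSoft {x y : S} : (ofSoft x : C.Ext) ≤ ofSoft y ↔ x ≤ y := by
  refine ⟨val_le, fun h => ?_⟩
  by_cases hx : x = 0
  · exact le_of_wayBelow (hx ▸ zero_wayBelow y)
  · exact le_of_not_cpt hx h

theorem isSoft_ofSoft (x : S) : IsSoft (ofSoft x : C.Ext) := by
  by_cases hx : x = 0
  · exact Or.inl (eq_zero_of_val_eq_zero hx)
  refine Or.inr ⟨fun h => hx (congrArg val h), fun p hp => ?_⟩
  obtain ⟨c, hc, hpc, hcx⟩ := exists_cpt_between hp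
  rcases eq_or_wayBelow hc hcx with rfl | hwb
  · exact absurd hc hx
  obtain ⟨t, ht0, ht⟩ := (C.soft x).exists_add_wayBelow hx hwb
  refine ⟨ofSoft t, fun h => ht0 (congrArg val h), wayBelow_of_val ?_⟩
  exact WayBelow.le_trans (add_le_add (val_le hpc) le_rfl) ht

theorem eq_ofSoft_of_isSoft {p : C.Ext} (hp : IsSoft p) : p = ofSoft p.val := by
  by_cases hcpt : p.cpt
  · rw [hp.eq_zero_of_isCompactElt weaklyCancellative (isCompactElt_of_cpt hcpt)]
    exact (eq_zero_of_val_eq_zero rfl).symm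
  · exact eq_of_not_cpt hcpt (p.ne_zero hcpt) rfl

/-- `S` is the soft part of the extension. -/
def softEquiv (C : CompactCore S) : S ≃+o softPart C.Ext where
  toFun x := ⟨ofSoft x, isSoft_ofSoft x⟩
  invFun p := p.1.val
  left_inv _ := rfl
  right_inv p := Subtype.ext (eq_ofSoft_of_isSoft p.2).symm
  map_add' x y := Subtype.ext (Ext.ext rfl (propext
    ⟨fun h => ⟨add_eq_zero_left h, add_eq_zero_right h⟩, fun h => by
      change x + y = 0
      rw [show x = 0 from h.1, show y = 0 from h.2, add_zero]⟩))
  map_le_map_iff' := ofSoft_le_ofSoft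

end CompactCore.Ext

/-! ### Soft and thin elements in algebraic semigroups -/

section AlgebraicSemigroup

variable {T : Type*} [AddCommMonoid T] [PartialOrder T]

theorem IsCompactElt.of_add (hc : WeaklyCancellative T) {a b : T} (h : IsCompactElt (a + b)) :
    IsCompactElt b := hc.cancel_left (z := a) h

variable [IsCuSemigroup T]

theorem Algebraic.exists_isCompactElt_le (hT : Algebraic T) {t : T} (ht : t ≠ 0) :
    ∃ c, IsCompactElt c ∧ c ≠ 0 ∧ c ≤ t := by
  obtain ⟨x, hx0, hx⟩ := exists_ne_zero_wayBelow ht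
  obtain ⟨c, hc, hxc, hct⟩ := hT x t hx
  exact ⟨c, hc, ne_zero_of_le hx0 hxc, hct.le⟩

theorem IsCompactElt.exists_add_eq (hO5 : O5 T) {a b : T} (ha : IsCompactElt a) (hab : a ≤ b) :
    ∃ c, a + c = b := by
  obtain ⟨c, h₁, h₂, -⟩ := hO5 a a 0 0 b (by rwa [add_zero]) ha (zero_wayBelow 0)
  exact ⟨c, le_antisymm h₁ h₂⟩

variable (hS : Simple T) (halg : Algebraic T) (hc : WeaklyCancellative T) (hO5 : O5 T)
  (hO6 : O6 T)

include hS in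
theorem Simple.le_of_forall_nsmul_le {c s : T} (hc0 : c ≠ 0) (h : ∀ n : ℕ, n • c ≤ s) (q : T) :
    q ≤ s := by
  refine le_of_forall_wayBelow fun x' hx' => ?_
  obtain ⟨n, hn⟩ := hS.exists_le_nsmul hc0 hx'
  exact hn.trans (h n)

include hS halg hO5 hO6 in
/-- If there is a nonzero soft element that is not the largest element, then every nonzero compact
element is the sum of two nonzero elements. -/
theorem IsCompactElt.exists_ne_zero_add_eq {s q : T} (hs : IsSoft s) (hs0 : s ≠ 0)
    (hq : ¬ q ≤ s) {c : T} (hcpt : IsCompactElt c) (hc0 : c ≠ 0) :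
    ∃ v r, v ≠ 0 ∧ r ≠ 0 ∧ v + r = c := by
  classical
  have hex : ∃ n : ℕ, ¬ n • c ≤ s := by
    by_contra! h
    exact hq (hS.le_of_forall_nsmul_le hc0 h q)
  obtain ⟨k, hk, hk'⟩ : ∃ k : ℕ, k • c ≤ s ∧ ¬ (k + 1) • c ≤ s := by
    obtain ⟨k, hk⟩ : ∃ k, Nat.find hex = k + 1 := Nat.exists_eq_succ_of_ne_zero fun h0 => by
      have := Nat.find_spec hex
      rw [h0, zero_nsmul] at this
      exact this (nonneg s)
    exact ⟨k, not_not.1 (Nat.find_min hex (hk ▸ Nat.lt_succ_self k)), hk ▸ Nat.find_spec hex⟩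
  have hkc : WayBelow (k • c) (k • c) := by
    simpa using WayBelow.sum (Finset.range k) (f := fun _ => c) (g := fun _ => c) fun _ _ => hcpt
  obtain ⟨t, ht0, ht⟩ := hs.exists_add_wayBelow hs0 (hkc.trans_le hk)
  obtain ⟨w, hw0, hwt, hwc⟩ := hS.exists_ne_zero_le hO6 ht0 hc0
  obtain ⟨v, hv, hv0, hvw⟩ := halg.exists_isCompactElt_le hw0
  obtain ⟨r, rfl⟩ := hv.exists_add_eq hO5 (hvw.trans hwc)
  -- Were `r = 0`, then `c = v ≤ t`, and `k • c + t ≪ s` would contradict the maximality of `k`.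
  refine ⟨v, r, hv0, fun hr => hk' ?_, rfl⟩
  rw [succ_nsmul]
  refine le_trans (add_le_add le_rfl ?_) ht.le
  rw [hr, add_zero]
  exact hvw.trans hwt

include hS halg hc hO5 hO6 in
/-- Every nonzero compact element `c` can be approximated from below by a soft element `b` that
agrees with `c` up to addition of arbitrarily small nonzero elements. -/
theorem IsCompactElt.exists_isSoft_le (hbased : CountablyBased T) {s q : T} (hs : IsSoft s)
    (hs0 : s ≠ 0) (hq : ¬ q ≤ s) {c : T} (hcpt : IsCompactElt c) (hc0 : c ≠ 0) :
    ∃ b, IsSoft b ∧ b ≠ 0 ∧ b ≤ c ∧ ∀ t, t ≠ 0 → c ≤ b + t := by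
  obtain ⟨d, hd⟩ := hbased.exists_seq
  have step : ∀ (n : ℕ) (p : {p : T // IsCompactElt p ∧ p ≠ 0}),
      ∃ (r : T) (p' : {p : T // IsCompactElt p ∧ p ≠ 0}), r ≠ 0 ∧ r + p'.1 = p.1 ∧
        (d n ≠ 0 → p'.1 ≤ d n) := by
    intro n p
    obtain ⟨w, hw0, hwp, hwd⟩ : ∃ w, w ≠ 0 ∧ w ≤ p.1 ∧ (d n ≠ 0 → w ≤ d n) := by
      by_cases h : d n = 0
      · exact ⟨p.1, p.2.2, le_rfl, fun h' => absurd h h'⟩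
      · obtain ⟨w, hw0, hwp, hwd⟩ := hS.exists_ne_zero_le hO6 p.2.2 h
        exact ⟨w, hw0, hwp, fun _ => hwd⟩
    obtain ⟨e, he, he0, hew⟩ := halg.exists_isCompactElt_le hw0
    obtain ⟨v, r, hv0, hr0, rfl⟩ :=
      he.exists_ne_zero_add_eq hS halg hO5 hO6 hs hs0 hq he0
    obtain ⟨r', hr'⟩ := he.exists_add_eq hO5 (hew.trans hwp)
    -- The remainder is the piece `r` of `e`, hence below `d n`; all else, including the nonzero
    -- `v`, is split off. These nonzero increments make the limit soft.
    refine ⟨v + r', ⟨r, he.of_add hc, hr0⟩, fun h => hv0 (add_eq_zero_left h), ?_, fun h => ?_⟩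
    · rw [add_right_comm]
      exact hr'
    · exact (le_add_self r v).trans (hew.trans (hwd h))
  choose f g hf hfg hg using step
  let p : ℕ → {p : T // IsCompactElt p ∧ p ≠ 0} := fun n => Nat.rec ⟨c, hcpt, hc0⟩ g n
  let P : ℕ → T := fun n => ∑ i ∈ Finset.range n, f i (p i)
  have hPs : ∀ n, P (n + 1) = P n + f n (p n) := fun n => Finset.sum_range_succ _ n
  have hPc : ∀ n, P n + (p n).1 = c := by
    intro n
    induction n with
    | zero => simp [P, p]
    | succ n ih => rw [hPs, add_assoc, ← ih]; exact congrArg (P n + ·) (hfg n (p n))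
  have hPcpt : ∀ n, IsCompactElt (P n) := fun n =>
    IsCompactElt.of_add hc (a := (p n).1) (by rw [add_comm, hPc]; exact hcpt)
  have hP : Monotone P := monotone_nat_of_le_succ fun n => by
    rw [hPs]; exact le_self_add _ _
  obtain ⟨b, hb⟩ := IsCuSemigroup.exists_sup P hP
  have hb0 : b ≠ 0 := by
    refine ne_zero_of_le (hf 0 (p 0)) (le_trans ?_ (hb.1 ⟨1, rfl⟩))
    rw [hPs]
    exact le_add_self _ _
  refine ⟨b, Or.inr ⟨hb0, fun x' hx' => ?_⟩, hb0, hb.2 ?_, fun t ht => ?_⟩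
  · obtain ⟨n, hn⟩ := hx' P hP b hb le_rfl
    refine ⟨f n (p n), hf n (p n), WayBelow.le_trans (y := P (n + 1)) ?_
      (WayBelow.trans_le (hPcpt (n + 1)) (hb.1 ⟨n + 1, rfl⟩))⟩
    rw [hPs]
    exact add_le_add hn le_rfl
  · rintro _ ⟨n, rfl⟩
    exact hPc n ▸ le_self_add _ _
  · obtain ⟨n, hn0, hn⟩ := hd t ht
    calc c = P (n + 1) + (p (n + 1)).1 := (hPc (n + 1)).symm
      _ ≤ b + t := add_le_add (hb.1 ⟨n + 1, rfl⟩) ((hg n (p n) hn0).trans hn)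

include hS halg hc hO5 hO6 in
theorem IsSoft.exists_isSoft_between (hbased : CountablyBased T) {s q : T} (hs : IsSoft s)
    (hs0 : s ≠ 0) (hq : ¬ q ≤ s) {x y : T} (hx : IsSoft x) (hyx : WayBelow y x) :
    ∃ z ∈ {z : T | IsSoft z}, y ≤ z ∧ WayBelow z x := by
  by_cases hx0 : x = 0
  · subst hx0
    exact ⟨0, Or.inl rfl, hyx.le, zero_wayBelow 0⟩
  obtain ⟨t, ht0, ht⟩ := hx.exists_add_wayBelow hx0 hyx
  obtain ⟨c, hcpt, hc0, hct⟩ := halg.exists_isCompactElt_le ht0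
  obtain ⟨b, hb, hb0, hbc, -⟩ :=
    hcpt.exists_isSoft_le hS halg hc hO5 hO6 hbased hs hs0 hq hc0
  exact ⟨y + b, hb.add_right_of_ne_zero hb0 y, le_self_add y b,
    WayBelow.le_trans (add_le_add le_rfl (hbc.trans hct)) ht⟩

theorem wayBelow_softPart_of_coe {x y : softPart T} (h : WayBelow (x : T) y) : WayBelow x y := by
  intro u hu s hs hys
  have hu' : Monotone fun n => (u n : T) := fun _ _ h => hu h
  obtain ⟨s', hs'⟩ := IsCuSemigroup.exists_sup _ hu'
  refine h _ hu' s' hs' (le_trans hys ?_)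
  have hsoft : IsSoft s' := isSoft_of_isLUB hu' (fun n => (u n).2) hs'
  exact hs.2 (show (⟨s', hsoft⟩ : softPart T) ∈ _ from by
    rintro _ ⟨n, rfl⟩
    exact hs'.1 ⟨n, rfl⟩)

include hS halg hc hO5 hO6 in
-- A soft `y` is the supremum in `T` of a `≪`-increasing sequence of soft elements, so testing
-- against sequences in the soft part suffices.
theorem coe_wayBelow_of_softPart (hbased : CountablyBased T) {s q : T} (hs : IsSoft s)
    (hs0 : s ≠ 0) (hq : ¬ q ≤ s) {x y : softPart T} (h : WayBelow x y) :
    WayBelow (x : T) y := by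
  obtain ⟨d, hd, hdd, hdy⟩ := exists_wayBelow_seq_mem (x := (y : T)) fun z hz =>
    IsSoft.exists_isSoft_between hS halg hc hO5 hO6 hbased hs hs0 hq y.2 hz
  obtain ⟨n, hn⟩ := h (fun n => (⟨d n, hd n⟩ : softPart T))
    (fun _ _ hij => monotone_of_wayBelow_succ hdd hij) y
    ⟨by rintro _ ⟨n, rfl⟩; exact hdy.1 ⟨n, rfl⟩, fun w hw => hdy.2 (by
      rintro _ ⟨n, rfl⟩; exact hw ⟨n, rfl⟩)⟩ le_rfl
  exact WayBelow.le_trans hn (wayBelow_of_isLUB hdd hdy n)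

include hS halg hc hO5 hO6 in
theorem isSupDense_hasThinBoundary_softPart (hbased : CountablyBased T) {s q : T} (hs : IsSoft s)
    (hs0 : s ≠ 0) (hq : ¬ q ≤ s) : IsSupDense {x : softPart T | HasThinBoundary x} := by
  intro x' x hx
  by_cases hx0 : x = 0
  · subst hx0
    exact ⟨0, fun t _ => wayBelow_softPart_of_coe (zero_wayBelow _), hx.le,
      wayBelow_softPart_of_coe (zero_wayBelow _)⟩
  have hxT := coe_wayBelow_of_softPart hS halg hc hO5 hO6 hbased hs hs0 hq hx
  have hx0' : (x : T) ≠ 0 := fun h => hx0 (Subtype.ext h)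
  obtain ⟨c₀, hc₀, hx'c₀, hc₀x⟩ := halg _ _ hxT
  obtain ⟨t, ht0, ht⟩ := x.2.exists_add_wayBelow hx0' hc₀x
  obtain ⟨c, hcpt, htc, hcx⟩ := halg _ _ ht
  obtain ⟨b, hb, -, hbc, hcb⟩ := hcpt.exists_isSoft_le hS halg hc hO5 hO6 hbased hs hs0 hq
    (ne_zero_of_le ht0 ((le_add_self t c₀).trans htc))
  refine ⟨⟨b, hb⟩, fun r hr => wayBelow_softPart_of_coe ?_, ?_,
    wayBelow_softPart_of_coe (WayBelow.le_trans hbc hcx)⟩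
  · exact WayBelow.le_trans hbc (WayBelow.trans_le hcpt (hcb r fun h => hr (Subtype.ext h)))
  -- The room `t` above `c₀` was kept so that `c₀ + t ≤ c ≤ b + t` gives `c₀ ≤ b`.
  · exact hx'c₀.trans (hc _ _ t
      (WayBelow.le_trans htc (WayBelow.trans_le hcpt (hcb t ht0)))).le

end AlgebraicSemigroup

/-! ### Transport along isomorphisms -/

section Transport

theorem WayBelow.map_orderIso {α β : Type*} [PartialOrder α] [PartialOrder β] (e : α ≃o β)
    {x y : α} (h : WayBelow x y) : WayBelow (e x) (e y) := by
  intro u hu s hs hys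
  obtain ⟨n, hn⟩ := h (fun n => e.symm (u n)) (e.symm.monotone.comp hu) (e.symm s)
    (by
      rw [Set.range_comp' e.symm u]
      exact e.symm.isLUB_image'.2 hs) (e.le_symm_apply.2 hys)
  exact ⟨n, e.le_symm_apply.1 hn⟩

theorem IsSupDense.of_orderAddMonoidIso {S T : Type*} [AddCommMonoid S] [PartialOrder S]
    [AddCommMonoid T] [PartialOrder T] (e : S ≃+o T)
    (h : IsSupDense {x : T | HasThinBoundary x}) : IsSupDense {x : S | HasThinBoundary x} := by
  intro x' x hx
  obtain ⟨b, hb, hxb, hbx⟩ := h (e x') (e x) (hx.map_orderIso (e : S ≃o T))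
  have hback : ∀ {y z : T}, WayBelow y z → WayBelow (e.symm y) (e.symm z) := fun h =>
    h.map_orderIso (e.symm : T ≃o S)
  refine ⟨e.symm b, fun t ht => ?_, ?_, ?_⟩
  · have := hback (hb (e t) fun h => ht (by simpa using h))
    simpa using this
  · exact (map_le_map_iff e).1 (by simpa using hxb)
  · simpa using hback hbx

end Transport

end CuntzSemigroup

/-! ### The equivalence -/

theorem mainTheorem7 (S : Type u) [AddCommMonoid S] [PartialOrder S] [IsCuSemigroup S]
    (hbased : CountablyBased S) (hsimple : Simple S) (hsoft : Soft S)
    (hcancel : WeaklyCancellative S) (hO5 : O5 S) (hO6 : O6 S) :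
    List.TFAE [
      dim S = 0,
      IsSupDense {x : S | HasThinBoundary x},
      ∃ (T : Type u) (_ : AddCommMonoid T) (_ : PartialOrder T) (_ : IsCuSemigroup T),
        CountablyBased T ∧ Simple T ∧ Algebraic T ∧ WeaklyCancellative T ∧ O5 T ∧ O6 T ∧
          Nonempty (S ≃+o softPart T)] := by
  tfae_have 1 → 2 := fun h => (dim_eq_zero_iff.1 h).isSupDense_hasThinBoundary hsimple hsoft
    hcancel hO5 hO6 hbased
  tfae_have 2 → 1 := fun h =>
    dim_eq_zero_iff.2 (dimLE_zero_of_isSupDense h hsoft hcancel hO5 hO6)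
  tfae_have 2 → 3 := fun h => by
    obtain ⟨C⟩ := exists_compactCore hbased hsimple hsoft hcancel hO5 hO6 h
    exact ⟨C.Ext, inferInstance, inferInstance, inferInstance, CompactCore.Ext.countablyBased,
      CompactCore.Ext.simple hsimple, CompactCore.Ext.algebraic,
      CompactCore.Ext.weaklyCancellative, CompactCore.Ext.o5 hO5, CompactCore.Ext.o6,
      ⟨CompactCore.Ext.softEquiv C⟩⟩
  tfae_have 3 → 2 := by
    rintro ⟨T, _, _, _, hTb, hTs, hTa, hTc, hT5, hT6, ⟨e⟩⟩
    by_cases hne : ∃ x : S, x ≠ 0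
    · obtain ⟨x, hx0⟩ := hne
      obtain ⟨y, hy0, hyx⟩ := exists_ne_zero_wayBelow hx0
      -- Splitting compact elements of `T` needs a nonzero soft element that is not the largest; `e
      -- y` serves, since `x ≤ y` would make `y` compact and soft.
      have hxy : ¬ x ≤ y := fun h =>
        hy0 ((hsoft y).eq_zero_of_isCompactElt hcancel (hyx.trans_le h))
      refine IsSupDense.of_orderAddMonoidIso e (isSupDense_hasThinBoundary_softPart hTs hTa hTc
        hT5 hT6 hTb (s := e y) (q := e x) (e y).2 (fun h => hy0 ?_) fun h => hxy ?_)
      · exact (map_eq_zero_iff e e.injective).1 (Subtype.ext h)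
      · exact (map_le_map_iff e).1 h
    · push Not at hne
      exact fun x' x hx => ⟨x', fun t ht => absurd (hne t) ht, le_rfl, hx⟩
  tfae_finish
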